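/- Let $(X,\mathcal B,\mu)$ be a standard Borel probability space and let $L_2(X)$ and $L_\infty(X)\subset L_2(X)$ be the corresponding spaces of complex-valued functions. Let $U=(U_t)_{t\in\mathbb R}$ be a unitary one-parameter $C_0$-group on $L_2(X)$, i.e. each $U_t$ is unitary, $U_0=I$, $U_{s+t}=U_sU_t$ for all $s,t\in\mathbb R$, and $t\mapsto U_tf$ is continuous for every $f\in L_2(X)$. Let $A$ be the generator of $U$, i.e. $Af=\lim_{t\to0}\frac1t(U_tf-f)$ with domain $D(A)$ the set of all $f\in L_2(X)$ for which this limit exists in $L_2(X)$. Then the following are equivalent. (i) For all $t\in\mathbb R$ there exists an a.e. invertible, measurable and measure-preserving map $T_t\colon X\to X$ such that $U_tf=f\circ T_t$ for all $f\in L_2(X)$. Here $T$ is called a.e. invertible if there is a measurable map $S\colon X\to X$ with $S(T(x))=x$ and $T(S(x))=x$ for $\mu$-a.e. $x\in X$. (ii) The space $L_\infty(X)$ is invariant under $U$, i.e. $U_t(L_\infty(X))\subset L_\infty(X)$ for all $t\in\mathbb R$. Moreover, $D(A)\cap L_\infty(X)$ is an algebra, i.e. $fg\in D(A)\cap L_\infty(X)$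 for all $f,g\in D(A)\cap L_\infty(X)$, and $A$ is a derivation on it, i.e. $A(fg)=(Af)\,g+f\,(Ag)$ for all $f,g\in D(A)\cap L_\infty(X)$. -/

import Mathlib

open MeasureTheory Filter Topology
open scoped ENNReal

namespace Koopman

/-- A unitary one-parameter `C₀`-group on a complex inner product space: a strongly continuous
one-parameter group of unitary operators (surjective linear isometries). -/
structure UnitaryC0Group (H : Type*) [NormedAddCommGroup H] [InnerProductSpace ℂ H] where
  /-- The unitary operator `U t`. -/
  toFun : ℝ → (H ≃ₗᵢ[ℂ] H)
  map_zero' : ∀ f : H, toFun 0 f = f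
  map_add' : ∀ (s t : ℝ) (f : H), toFun (s + t) f = toFun s (toFun t f)
  continuous' : ∀ f : H, Continuous fun t : ℝ => toFun t f

instance {H : Type*} [NormedAddCommGroup H] [InnerProductSpace ℂ H] :
    CoeFun (UnitaryC0Group H) (fun _ => ℝ → (H ≃ₗᵢ[ℂ] H)) := ⟨UnitaryC0Group.toFun⟩

section Generator

variable {H : Type*} [NormedAddCommGroup H] [InnerProductSpace ℂ H]

/-- `(f, g)` belongs to the graph of the generator of `U`:
`g = lim_{t → 0} (U_t f - f) / t` in norm. -/
def HasGenerator (U : UnitaryC0Group H) (f g : H) : Prop :=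
  Tendsto (fun t : ℝ => (t : ℂ)⁻¹ • (U t f - f)) (𝓝[≠] 0) (𝓝 g)

theorem HasGenerator.add {U : UnitaryC0Group H} {f₁ f₂ g₁ g₂ : H}
    (h₁ : HasGenerator U f₁ g₁) (h₂ : HasGenerator U f₂ g₂) :
    HasGenerator U (f₁ + f₂) (g₁ + g₂) := by
  refine (Tendsto.add h₁ h₂).congr fun t => ?_
  rw [← smul_add, map_add]
  congr 1
  abel

theorem HasGenerator.smul {U : UnitaryC0Group H} {f g : H} (c : ℂ)
    (h : HasGenerator U f g) : HasGenerator U (c • f) (c • g) := by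
  refine (Tendsto.const_smul h c).congr fun t => ?_
  rw [map_smul, ← smul_sub, smul_comm]

theorem HasGenerator.unique {U : UnitaryC0Group H} {f g₁ g₂ : H}
    (h₁ : HasGenerator U f g₁) (h₂ : HasGenerator U f g₂) : g₁ = g₂ :=
  tendsto_nhds_unique h₁ h₂

/-- The generator `A` of `U`: the unbounded operator whose domain `D(A)` consists of all `f` for
which `lim_{t → 0} (U_t f - f) / t` exists in norm, and whose value at `f` is this limit. -/
noncomputable def generator (U : UnitaryC0Group H) : H →ₗ.[ℂ] H where
  domain :=
    { carrier := {f | ∃ g, HasGenerator U f g}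
      add_mem' := fun ⟨g₁, h₁⟩ ⟨g₂, h₂⟩ => ⟨g₁ + g₂, h₁.add h₂⟩
      zero_mem' := ⟨0, by simp [HasGenerator]⟩
      smul_mem' := fun c _ ⟨g, h⟩ => ⟨c • g, h.smul c⟩ }
  toFun :=
    { toFun := fun f => f.2.choose
      map_add' := fun f₁ f₂ =>
        (f₁ + f₂).2.choose_spec.unique (f₁.2.choose_spec.add f₂.2.choose_spec)
      map_smul' := fun c f => (c • f).2.choose_spec.unique (f.2.choose_spec.smul c) }

end Generator

section L2

variable {X : Type*} [MeasurableSpace X]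

/-- The space `L_∞(X)`, as a subspace of `L_2(X)`; if `μ` is a finite measure, every
essentially bounded function is in `L_2(X)`, so this is all of `L_∞(X)`. -/
def Linfty (μ : Measure X) : Submodule ℂ (Lp ℂ 2 μ) where
  carrier := {f | MemLp f ∞ μ}
  add_mem' := fun {f g} hf hg => (memLp_congr_ae (Lp.coeFn_add f g)).2 (hf.add hg)
  zero_mem' := (memLp_congr_ae (Lp.coeFn_zero ℂ 2 μ)).2 MemLp.zero'
  smul_mem' := fun c f hf => (memLp_congr_ae (Lp.coeFn_smul c f)).2 (hf.const_smul c)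

/-- A subspace `D` of `L_2(X)` is an algebra (under pointwise a.e. multiplication): the product of
two elements of `D` is again an element of `D`. -/
def IsAlgebra {μ : Measure X} (D : Submodule ℂ (Lp ℂ 2 μ)) : Prop :=
  ∀ f ∈ D, ∀ g ∈ D, ∃ h ∈ D, h =ᵐ[μ] fun x => f x * g x

/-- The operator `A` in `L_2(X)` is a derivation on `D ⊆ D(A)`: whenever `f, g ∈ D` and `h ∈ D` is
the product `f g`, one has `A h = (A f) g + f (A g)` a.e. -/
def IsDerivationOn {μ : Measure X} (A : Lp ℂ 2 μ →ₗ.[ℂ] Lp ℂ 2 μ)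
    (D : Submodule ℂ (Lp ℂ 2 μ)) : Prop :=
  D ≤ A.domain ∧
    ∀ f g h : A.domain, (f : Lp ℂ 2 μ) ∈ D → (g : Lp ℂ 2 μ) ∈ D → (h : Lp ℂ 2 μ) ∈ D →
      ((h : Lp ℂ 2 μ) =ᵐ[μ] fun x => (f : Lp ℂ 2 μ) x * (g : Lp ℂ 2 μ) x) →
      A h =ᵐ[μ] fun x => A f x * (g : Lp ℂ 2 μ) x + (f : Lp ℂ 2 μ) x * A g x

/-- `T` is invertible `μ`-a.e.: it has a measurable two-sided inverse up to `μ`-null sets. -/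
def IsAEInvertible (μ : Measure X) (T : X → X) : Prop :=
  ∃ S : X → X, Measurable S ∧ (∀ᵐ x ∂μ, S (T x) = x) ∧ (∀ᵐ x ∂μ, T (S x) = x)

end L2

end Koopman

/-! If every `U t` is composition with a measure-preserving map, it is multiplicative and keeps
essential bounds, so the product rule for `t ↦ U t f * U t g` at `0` gives (ii)
(`exists_hasGenerator_mul`).

Conversely, for bounded `f`, `g` in the domain, put `q s = U s f * U s g`. The derivation property
says `q' = A q`, so `U (-s) (q s)` is constant and `U` is multiplicative on these functions
(`apply_mul_of_mem_domain`). The product rule needs bounds that are locally uniform in time, while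
invariance of `L_∞` only bounds each `U t f` separately. Baire's theorem supplies the uniformity
(`eventually_apply_mem_boundedBy`). The same bounds put short-time averages of orbits in `L_∞`, so
bounded elements of the domain approximate all of `L_∞`, and multiplicativity extends.

A multiplicative unitary maps indicators to indicators and respects complements, intersections and
countable unions. A countable separating family of Borel sets turns this set map into a point map
(`IsMultiplicative.exists_measurePreserving`). The map for `-t` inverts the map for `t`. -/

namespace Koopman

/-! ### Bounded functions and products in `L_2` -/

section Products

variable {X : Type*} [MeasurableSpace X] {μ : Measure X}

/-- The elements of `L_2(X)` that are bounded by `c` almost everywhere. -/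
def boundedBy (μ : Measure X) (c : ℝ) : Set (Lp ℂ 2 μ) := {f | ∀ᵐ x ∂μ, ‖f x‖ ≤ c}

theorem mem_Linfty_iff {f : Lp ℂ 2 μ} : f ∈ Linfty μ ↔ ∃ c, f ∈ boundedBy μ c := by
  constructor
  · intro h
    have h : MemLp f ∞ μ := h
    refine ⟨(eLpNorm f ∞ μ).toReal, ?_⟩
    have h2 := ae_le_eLpNormEssSup (f := f) (μ := μ)
    rw [← eLpNorm_exponent_top] at h2
    filter_upwards [h2] with x hx
    rw [← toReal_enorm]
    exact ENNReal.toReal_mono h.2.ne hx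
  · rintro ⟨c, hc⟩
    exact memLp_top_of_bound (Lp.aestronglyMeasurable f) c hc

theorem boundedBy_mono {c d : ℝ} (h : c ≤ d) : boundedBy μ c ⊆ boundedBy μ d :=
  fun f (hf : ∀ᵐ x ∂μ, ‖f x‖ ≤ c) => hf.mono fun _ hx => hx.trans h

theorem smul_mem_boundedBy {c : ℝ} {f : Lp ℂ 2 μ} (hf : f ∈ boundedBy μ c) (z : ℂ) :
    z • f ∈ boundedBy μ (‖z‖ * c) := by
  filter_upwards [hf, Lp.coeFn_smul z f] with x hx h
  rw [h, Pi.smul_apply, norm_smul]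
  gcongr

theorem add_mem_boundedBy {c d : ℝ} {f g : Lp ℂ 2 μ} (hf : f ∈ boundedBy μ c)
    (hg : g ∈ boundedBy μ d) : f + g ∈ boundedBy μ (c + d) := by
  filter_upwards [hf, hg, Lp.coeFn_add f g] with x hx hy h
  rw [h]
  exact (norm_add_le _ _).trans (add_le_add hx hy)

theorem sub_mem_boundedBy {c d : ℝ} {f g : Lp ℂ 2 μ} (hf : f ∈ boundedBy μ c)
    (hg : g ∈ boundedBy μ d) : f - g ∈ boundedBy μ (c + d) := by
  filter_upwards [hf, hg, Lp.coeFn_sub f g] with x hx hy h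
  rw [h]
  exact (norm_sub_le _ _).trans (add_le_add hx hy)

theorem convex_boundedBy (c : ℝ) : Convex ℝ (boundedBy μ c) := by
  intro f hf g hg a b ha hb hab
  filter_upwards [hf, hg, Lp.coeFn_add (a • f) (b • g), Lp.coeFn_smul a f, Lp.coeFn_smul b g]
    with x hx hy h h1 h2
  rw [h, Pi.add_apply, h1, h2, Pi.smul_apply, Pi.smul_apply]
  refine (norm_add_le _ _).trans ?_
  rw [norm_smul, norm_smul, Real.norm_of_nonneg ha, Real.norm_of_nonneg hb]
  calc a * ‖f x‖ + b * ‖g x‖ ≤ a * c + b * c := by gcongr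
    _ = c := by rw [← add_mul, hab, one_mul]

/-- An `L_2`-convergent sequence has a subsequence converging a.e., along which the bound persists.
This closedness is what Baire's theorem and the averaging argument rely on. -/
theorem isClosed_boundedBy (c : ℝ) : IsClosed (boundedBy μ c) := by
  refine IsSeqClosed.isClosed fun u f hu hf => ?_
  obtain ⟨ns, -, h⟩ := (tendstoInMeasure_of_tendsto_Lp hf).exists_seq_tendsto_ae
  filter_upwards [h, ae_all_iff.2 hu] with x hx hux
  exact le_of_tendsto hx.norm (Eventually.of_forall fun i => hux _)

theorem exists_mul_eq_of_mem_boundedBy {c : ℝ} (f : Lp ℂ 2 μ) {g : Lp ℂ 2 μ}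
    (hg : g ∈ boundedBy μ c) : ∃ h : Lp ℂ 2 μ, h =ᵐ[μ] fun x => f x * g x :=
  have hg' : MemLp g ∞ μ := mem_Linfty_iff.2 ⟨c, hg⟩
  ⟨_, MemLp.coeFn_toLp (hg'.mul' (r := 2) (Lp.memLp f))⟩

theorem mul_mem_boundedBy {c d : ℝ} {f g h : Lp ℂ 2 μ} (hf : f ∈ boundedBy μ c)
    (hg : g ∈ boundedBy μ d) (hh : h =ᵐ[μ] fun x => f x * g x) : h ∈ boundedBy μ (c * d) := by
  filter_upwards [hf, hg, hh] with x hx hy h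
  rw [h, norm_mul]
  exact mul_le_mul hx hy (norm_nonneg _) ((norm_nonneg _).trans hx)

theorem norm_le_of_ae_eq_mul {c : ℝ} {f g h : Lp ℂ 2 μ} (hg : g ∈ boundedBy μ c)
    (hh : h =ᵐ[μ] fun x => f x * g x) : ‖h‖ ≤ c * ‖f‖ := by
  refine Lp.norm_le_mul_norm_of_ae_le_mul ?_
  filter_upwards [hg, hh] with x hx h
  rw [h, norm_mul, mul_comm]
  gcongr

theorem ae_eq_mul_comm {f g h : Lp ℂ 2 μ} (hh : h =ᵐ[μ] fun x => f x * g x) :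
    h =ᵐ[μ] fun x => g x * f x := by
  simpa only [mul_comm] using hh

theorem dense_Linfty : Dense (Linfty μ : Set (Lp ℂ 2 μ)) := by
  refine (Lp.simpleFunc.dense (E := ℂ) (p := 2) (μ := μ) (by simp)).mono fun f hf => ?_
  obtain ⟨s, hs⟩ := hf
  have : f =ᵐ[μ] s := by
    rw [← hs]
    exact AEEqFun.coeFn_mk _ _
  exact (memLp_congr_ae this).2 (s.memLp_top μ)

/-- Multiplication is continuous from `L_2 × L_2` to `L_2` when the second factor stays
bounded in `L_∞`. -/
theorem tendsto_mul {ι : Type*} {l : Filter ι} {u v w : ι → Lp ℂ 2 μ} {f g h : Lp ℂ 2 μ}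
    {c : ℝ} (hu : Tendsto u l (𝓝 f)) (hv : Tendsto v l (𝓝 g)) (hg : g ∈ boundedBy μ c)
    (hvc : ∀ᶠ i in l, v i ∈ boundedBy μ c) (hw : ∀ i, w i =ᵐ[μ] fun x => u i x * v i x)
    (hh : h =ᵐ[μ] fun x => f x * g x) : Tendsto w l (𝓝 h) := by
  rw [Metric.tendsto_nhds]
  intro ε hε
  set c' := max c 0
  have hc' : 0 ≤ c' := le_max_right _ _
  have hg' : g ∈ boundedBy μ c' := boundedBy_mono (le_max_left _ _) hg
  -- As `f` need not be bounded, a bounded `k` within `δ` of `f` is inserted: `uv - fg = (u - k)v +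
  -- k(v - g) + (k - f)g`. The outer terms contribute at most `3c'δ ≤ 3ε/4 - 3δ`, the middle one at
  -- most `ε/4`.
  set δ := ε / (4 * (c' + 1)) with hδdef
  have hδ : 0 < δ := by positivity
  obtain ⟨k, hk, hfk⟩ := Metric.dense_iff.1 (dense_Linfty (μ := μ)) f δ hδ |>.imp
    fun k hk => And.intro hk.2 hk.1
  obtain ⟨d, hd⟩ := mem_Linfty_iff.1 hk
  set d' := max d 0
  have hd' : k ∈ boundedBy μ d' := boundedBy_mono (le_max_left _ _) hd
  have hd0 : 0 ≤ d' := le_max_right _ _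
  have e1 := Metric.tendsto_nhds.1 hu δ hδ
  have e2 := Metric.tendsto_nhds.1 hv (ε / (4 * (d' + 1))) (by positivity)
  filter_upwards [e1, e2, hvc] with i h1 h2 h3
  have h3' : v i ∈ boundedBy μ c' := boundedBy_mono (le_max_left _ _) h3
  obtain ⟨p, hp⟩ := exists_mul_eq_of_mem_boundedBy (u i - k) h3'
  obtain ⟨q, hq⟩ := exists_mul_eq_of_mem_boundedBy (v i - g) hd'
  obtain ⟨r, hr⟩ := exists_mul_eq_of_mem_boundedBy (k - f) hg'
  have key : w i - h = p + q + r := by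
    refine Lp.ext ?_
    filter_upwards [hp, hq, hr, hw i, hh, Lp.coeFn_sub (w i) h, Lp.coeFn_add (p + q) r,
      Lp.coeFn_add p q, Lp.coeFn_sub (u i) k, Lp.coeFn_sub (v i) g, Lp.coeFn_sub k f]
      with x a1 a2 a3 a4 a5 a6 a7 a8 a9 a10 a11
    rw [a6, a7, Pi.add_apply, a8, Pi.sub_apply, Pi.add_apply, a1, a2, a3, a4, a5, a9, a10, a11]
    simp only [Pi.sub_apply]
    ring
  have b1 := norm_le_of_ae_eq_mul h3' hp
  have b2 := norm_le_of_ae_eq_mul hd' hq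
  have b3 := norm_le_of_ae_eq_mul hg' hr
  rw [dist_eq_norm] at h1 h2
  rw [Metric.mem_ball, dist_eq_norm] at hfk
  have b4 : ‖u i - k‖ ≤ 2 * δ := by
    calc ‖u i - k‖ = ‖(u i - f) - (k - f)‖ := by congr 1; abel
      _ ≤ ‖u i - f‖ + ‖k - f‖ := norm_sub_le _ _
      _ ≤ 2 * δ := by linarith
  rw [dist_eq_norm, key]
  have c1 : c' * δ ≤ ε / 4 - δ := by
    rw [hδdef]; field_simp; ring_nf; rfl
  have c2 : d' * (ε / (4 * (d' + 1))) ≤ ε / 4 := by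
    rw [mul_div_assoc', div_le_div_iff₀ (by positivity) (by positivity)]
    nlinarith
  calc ‖p + q + r‖ ≤ ‖p‖ + ‖q‖ + ‖r‖ := norm_add₃_le
    _ ≤ c' * (2 * δ) + d' * (ε / (4 * (d' + 1))) + c' * δ := by
      gcongr
      · exact b1.trans (by gcongr)
      · exact b2.trans (by gcongr)
      · exact b3.trans (by gcongr)
    _ < ε := by linarith

/-- The product rule for curves in `L_2` whose values stay bounded in `L_∞`. -/
theorem hasDerivAt_mul {u v w : ℝ → Lp ℂ 2 μ} {f' g' h' : Lp ℂ 2 μ} {c : ℝ} {s : ℝ}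
    (hu : HasDerivAt u f' s) (hv : HasDerivAt v g' s)
    (huc : ∃ d, u s ∈ boundedBy μ d) (hvc : ∀ᶠ t in 𝓝 s, v t ∈ boundedBy μ c)
    (hw : ∀ t, w t =ᵐ[μ] fun x => u t x * v t x)
    (hh : h' =ᵐ[μ] fun x => f' x * v s x + u s x * g' x) : HasDerivAt w h' s := by
  obtain ⟨d, hd⟩ := huc
  have hvs : v s ∈ boundedBy μ c := hvc.self_of_nhds
  obtain ⟨p', hp'⟩ := exists_mul_eq_of_mem_boundedBy f' hvs
  obtain ⟨q', hq'⟩ := exists_mul_eq_of_mem_boundedBy g' hd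
  -- The slope of `w` splits as `slope u * v t + u s * slope v`, and `q` is the second term. Only `u
  -- s` and the nearby `v t` have to be bounded.
  have hvc' : ∀ t, ∃ z : Lp ℂ 2 μ, z =ᵐ[μ] fun x => slope v s t x * u s x :=
    fun t => exists_mul_eq_of_mem_boundedBy _ hd
  choose q hq using hvc'
  have hpe : ∀ t, w t - w s - (t - s) • q t =ᵐ[μ] fun x => (u t - u s) x * v t x := by
    intro t
    have hs : v t - v s = (t - s) • slope v s t := (sub_smul_slope v s t).symm
    filter_upwards [Lp.coeFn_sub (w t - w s) ((t - s) • q t), Lp.coeFn_sub (w t) (w s),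
      Lp.coeFn_smul (t - s) (q t), hq t, hw t, hw s, Lp.coeFn_sub (u t) (u s),
      Lp.coeFn_sub (v t) (v s), Lp.coeFn_smul (t - s) (slope v s t)]
      with x a1 a2 a3 a4 a5 a6 a7 a8 a9
    rw [hs, a9] at a8
    simp only [Pi.sub_apply, Pi.smul_apply] at *
    rw [a1, a2, a3, a4, a5, a6, a7, ← smul_mul_assoc, a8]
    ring
  rw [hasDerivAt_iff_tendsto_slope] at hu hv ⊢
  have t2 : Tendsto q (𝓝[≠] s) (𝓝 q') :=
    tendsto_mul hv tendsto_const_nhds hd (Eventually.of_forall fun _ => hd) hq hq'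
  have hvt : Tendsto v (𝓝[≠] s) (𝓝 (v s)) := by
    have h1 : Tendsto (fun t => (t - s) • slope v s t + v s) (𝓝[≠] s)
        (𝓝 ((s - s) • g' + v s)) := by
      refine Tendsto.add_const _ (Tendsto.smul ?_ hv)
      exact ((continuous_id.sub continuous_const).tendsto s).mono_left nhdsWithin_le_nhds
    simpa using h1
  -- `tendsto_mul` requires the product identity at every `t`. At `t = s` the slopes of `w` and `u`
  -- are `0`, hence the value `0` there.
  have t1 : Tendsto (fun t => slope w s t - (if t = s then 0 else q t)) (𝓝[≠] s) (𝓝 p') := by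
    refine tendsto_mul hu hvt hvs (nhdsWithin_le_nhds hvc) (fun t => ?_) hp'
    by_cases hts : t = s
    · subst hts
      rw [if_pos rfl, slope_same, slope_same, sub_zero]
      filter_upwards [Lp.coeFn_zero ℂ 2 μ] with x hx
      rw [hx, Pi.zero_apply, zero_mul]
    · have ht : t - s ≠ 0 := sub_ne_zero.2 hts
      have e : slope w s t - (if t = s then 0 else q t)
          = (t - s)⁻¹ • (w t - w s - (t - s) • q t) := by
        rw [if_neg hts, slope_def_module, smul_sub _ _ ((t - s) • q t), smul_smul,
          inv_mul_cancel₀ ht, one_smul]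
      rw [e]
      filter_upwards [hpe t, Lp.coeFn_smul (t - s)⁻¹ (w t - w s - (t - s) • q t),
        Lp.coeFn_smul (t - s)⁻¹ (u t - u s)] with x a1 a2 a3
      rw [a2, slope_def_module, a3, Pi.smul_apply, Pi.smul_apply, a1, smul_mul_assoc]
  have hsum : p' + q' = h' := by
    refine Lp.ext ?_
    filter_upwards [hh, hp', hq', Lp.coeFn_add p' q'] with x a1 a2 a3 a4
    rw [a4, a1, Pi.add_apply, a2, a3, mul_comm (u s x)]
  rw [← hsum]
  refine (t1.add t2).congr' ?_
  filter_upwards [self_mem_nhdsWithin] with t ht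
  rw [if_neg (show t ≠ s from ht), sub_add_cancel]

end Products

end Koopman

namespace Koopman

/-! ### Orbits and the product rule for the generator -/

section Group

variable {X : Type*} [MeasurableSpace X] {μ : Measure X} {U : UnitaryC0Group (Lp ℂ 2 μ)}

theorem hasGenerator_iff_hasDerivAt {f g : Lp ℂ 2 μ} :
    HasGenerator U f g ↔ HasDerivAt (fun t : ℝ => U t f) g 0 := by
  rw [hasDerivAt_iff_tendsto_slope_zero]
  refine tendsto_congr fun t => ?_
  rw [U.map_zero', zero_add, ← Complex.ofReal_inv]
  rfl

theorem HasGenerator.apply {f g : Lp ℂ 2 μ} (h : HasGenerator U f g) (s : ℝ) :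
    HasGenerator U (U s f) (U s g) := by
  refine (((U s).continuous.tendsto g).comp h).congr fun t => ?_
  rw [Function.comp_apply, map_smul, map_sub, ← U.map_add', ← U.map_add', add_comm]

theorem HasGenerator.hasDerivAt {f g : Lp ℂ 2 μ} (h : HasGenerator U f g) (s : ℝ) :
    HasDerivAt (fun t : ℝ => U t f) (U s g) s := by
  have h1 := hasGenerator_iff_hasDerivAt.1 (h.apply s)
  rw [← sub_self s] at h1
  refine (h1.comp_sub_const s s).congr_of_eventuallyEq (Eventually.of_forall fun t => ?_)
  simp only [← U.map_add', sub_add_cancel]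

theorem hasGenerator_generator {f : Lp ℂ 2 μ} (hf : f ∈ (generator U).domain) :
    HasGenerator U f (generator U ⟨f, hf⟩) := hf.choose_spec

/-- The derivative of `t ↦ U_{-t} q(t)` vanishes where `q' = A q`. -/
theorem hasDerivAt_apply_neg {q : ℝ → Lp ℂ 2 μ} {k : Lp ℂ 2 μ} {s : ℝ} (hq : HasDerivAt q k s)
    (hk : HasGenerator U (q s) k) : HasDerivAt (fun t => U (-t) (q t)) 0 s := by
  have h1 := hasGenerator_iff_hasDerivAt.1 hk
  rw [← sub_self s] at h1
  have h2 := h1.comp_sub_const s s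
  -- `q t` and `U (t - s) (q s)` agree to first order at `s`. The isometry `U (-t)` maps their
  -- difference to `U (-t) (q t) - U (-s) (q s)`, so comparing norms of difference quotients
  -- suffices.
  have h3 := hq.sub h2
  rw [sub_self, hasDerivAt_iff_tendsto_slope] at h3
  rw [hasDerivAt_iff_tendsto_slope]
  rw [tendsto_zero_iff_norm_tendsto_zero] at h3 ⊢
  refine h3.congr fun t => ?_
  rw [slope_def_module, slope_def_module, norm_smul, norm_smul]
  congr 1
  rw [← (U (-t)).norm_map]
  congr 1
  simp only [Pi.sub_apply, map_sub, ← U.map_add', sub_self, U.map_zero']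
  rw [show -t + (t - s) = -s by ring, map_zero, sub_zero]

theorem continuous_apply_prod (U : UnitaryC0Group (Lp ℂ 2 μ)) :
    Continuous fun p : Lp ℂ 2 μ × ℝ => U p.2 p.1 :=
  continuous_prod_of_continuous_lipschitzWith _ 1 (fun f => U.continuous' f)
    (fun t => (U t).isometry.lipschitz)

/-- The orbit of `h` is the product of the orbits of `f` and `g`, which stay bounded uniformly in
time and are differentiable at `0`, so the product rule applies there. -/
theorem exists_hasGenerator_mul
    (hB : ∀ t c f, f ∈ boundedBy μ c → U t f ∈ boundedBy μ c)
    (hM : ∀ t, ∀ f g h : Lp ℂ 2 μ, (h =ᵐ[μ] fun x => f x * g x) →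
      U t h =ᵐ[μ] fun x => U t f x * U t g x)
    {f g h f' g' : Lp ℂ 2 μ} (hf : f ∈ Linfty μ) (hg : g ∈ Linfty μ)
    (hh : h =ᵐ[μ] fun x => f x * g x) (hf' : HasGenerator U f f') (hg' : HasGenerator U g g') :
    ∃ h', HasGenerator U h h' ∧ h' =ᵐ[μ] fun x => f' x * g x + f x * g' x := by
  obtain ⟨c, hc⟩ := mem_Linfty_iff.1 hf
  obtain ⟨d, hd⟩ := mem_Linfty_iff.1 hg
  obtain ⟨p, hp⟩ := exists_mul_eq_of_mem_boundedBy f' hd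
  obtain ⟨q, hq⟩ := exists_mul_eq_of_mem_boundedBy g' hc
  have hpq : p + q =ᵐ[μ] fun x => f' x * g x + f x * g' x := by
    filter_upwards [hp, hq, Lp.coeFn_add p q] with x a1 a2 a3
    rw [a3, Pi.add_apply, a1, a2, mul_comm (f x)]
  refine ⟨p + q, ?_, hpq⟩
  rw [hasGenerator_iff_hasDerivAt] at hf' hg' ⊢
  refine hasDerivAt_mul hf' hg' ⟨c, hB _ _ _ hc⟩ (Eventually.of_forall fun t => hB t _ _ hd)
    (fun t => hM t _ _ _ hh) ?_
  simpa only [U.map_zero'] using hpq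

/-! ### Local `L_∞` bounds and density of bounded elements of the domain -/

/-- The Baire category theorem on the product of a closed subset of a complete space with `ℝ`. -/
theorem exists_ball_of_iUnion_of_closed {E F : Type*} [NormedAddCommGroup E] [CompleteSpace E]
    [TopologicalSpace F] {K : Set E} (hK : IsClosed K) (hne : K.Nonempty) {Φ : E × ℝ → F}
    (hΦ : Continuous Φ) {B : ℕ → Set F} (hB : ∀ n, IsClosed (B n))
    (hcover : ∀ g ∈ K, ∀ t, ∃ n, Φ (g, t) ∈ B n) :
    ∃ n, ∃ f₀ ∈ K, ∃ t₀ r : ℝ, 0 < r ∧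
      ∀ g ∈ K, ∀ t, ‖g - f₀‖ < r → |t - t₀| < r → Φ (g, t) ∈ B n := by
  have hcs : CompleteSpace K := hK.completeSpace_coe
  have hKne : Nonempty K := hne.to_subtype
  have hF : Continuous fun p : K × ℝ => Φ (p.1, p.2) :=
    hΦ.comp (continuous_subtype_val.prodMap continuous_id)
  obtain ⟨n, ⟨f₀, t₀⟩, hp⟩ := nonempty_interior_of_iUnion_of_closed
    (fun n => (hB n).preimage hF)
    (Set.eq_univ_of_forall fun p => Set.mem_iUnion.2 (hcover p.1 p.1.2 p.2))
  rw [mem_interior_iff_mem_nhds, Metric.mem_nhds_iff] at hp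
  obtain ⟨r, hr, hball⟩ := hp
  refine ⟨n, f₀, f₀.2, t₀, r, hr, fun g hg t h1 h2 => ?_⟩
  have hmem : ((⟨g, hg⟩ : K), t) ∈ Metric.ball (f₀, t₀) r := by
    rw [Metric.mem_ball, Prod.dist_eq, max_lt_iff, Subtype.dist_eq, dist_eq_norm, Real.dist_eq]
    exact ⟨h1, h2⟩
  exact Set.mem_preimage.1 (hball hmem)

theorem zero_mem_boundedBy : (0 : Lp ℂ 2 μ) ∈ boundedBy μ 1 := by
  filter_upwards [Lp.coeFn_zero ℂ 2 μ] with x hx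
  rw [hx, Pi.zero_apply, norm_zero]
  exact zero_le_one

/-- If `U` leaves `L_∞` invariant, then `U t g` is uniformly bounded in `L_∞` for `(g, t)` in a
nonempty relatively open part of the unit ball of `L_∞` times `ℝ`. -/
theorem exists_ball_apply_mem_boundedBy (hU : ∀ t : ℝ, ∀ f ∈ Linfty μ, U t f ∈ Linfty μ) :
    ∃ c : ℝ, ∃ f₀ ∈ boundedBy μ 1, ∃ t₀ r : ℝ, 0 < r ∧
      ∀ g ∈ boundedBy μ 1, ∀ t, ‖g - f₀‖ < r → |t - t₀| < r → U t g ∈ boundedBy μ c := by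
  -- The unit ball of `L_∞` is complete for the `L_2` norm. By joint continuity the pairs `(g, t)`
  -- with `U t g` bounded by `n` form closed sets, and invariance makes them cover.
  obtain ⟨n, h⟩ := exists_ball_of_iUnion_of_closed (isClosed_boundedBy (μ := μ) 1)
    ⟨0, zero_mem_boundedBy⟩ (continuous_apply_prod U)
    (fun n : ℕ => isClosed_boundedBy (μ := μ) (n : ℝ)) fun g hg t => by
      obtain ⟨c, hc⟩ := mem_Linfty_iff.1 (hU t g (mem_Linfty_iff.2 ⟨1, hg⟩))
      obtain ⟨n, hn⟩ := exists_nat_ge c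
      exact ⟨n, boundedBy_mono hn hc⟩
  exact ⟨n, h⟩

/-- If `U` leaves `L_∞` invariant, then the orbit of a bounded function is bounded in `L_∞` near
time `0`. -/
theorem eventually_apply_mem_boundedBy (hU : ∀ t : ℝ, ∀ f ∈ Linfty μ, U t f ∈ Linfty μ)
    {f : Lp ℂ 2 μ} (hf : f ∈ Linfty μ) : ∃ c, ∀ᶠ t in 𝓝 (0 : ℝ), U t f ∈ boundedBy μ c := by
  obtain ⟨c₀, f₀, hf₀, t₀, r, hr, hball⟩ := exists_ball_apply_mem_boundedBy hU
  -- A given `g` in the unit ball is reached from the small ball: `k = (1 - l) f₀ + l g` lies in the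
  -- unit ball by convexity and within `r` of `f₀` for this `l`, and `U t g` is recovered linearly
  -- from `U t k` and `U t f₀`. The bound may depend on `g`.
  have step : ∀ g ∈ boundedBy μ 1, ∃ c, ∀ t, |t - t₀| < r → U t g ∈ boundedBy μ c := by
    intro g hg
    set l : ℝ := r / (r + ‖g - f₀‖) with hl
    have hl0 : 0 < l := by positivity
    have hl1 : l ≤ 1 := div_le_one_of_le₀ (by linarith [norm_nonneg (g - f₀)]) (by positivity)
    have hl2 : l * ‖g - f₀‖ < r := by
      rw [hl, div_mul_eq_mul_div, div_lt_iff₀ (by positivity)]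
      nlinarith [norm_nonneg (g - f₀)]
    obtain ⟨k, hk⟩ : ∃ k : Lp ℂ 2 μ, k = ((1 - l : ℝ) : ℂ) • f₀ + (l : ℂ) • g := ⟨_, rfl⟩
    have hkB : k ∈ boundedBy μ 1 := by
      have := add_mem_boundedBy (smul_mem_boundedBy hf₀ ((1 - l : ℝ) : ℂ))
        (smul_mem_boundedBy hg (l : ℂ))
      rwa [Complex.norm_real, Complex.norm_real, Real.norm_of_nonneg (by linarith),
        Real.norm_of_nonneg hl0.le, mul_one, mul_one, sub_add_cancel, ← hk] at this
    have hkf : k - f₀ = (l : ℂ) • (g - f₀) := by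
      rw [hk]; push_cast; module
    refine ⟨‖(l : ℂ)⁻¹‖ * (c₀ + ‖((1 - l : ℝ) : ℂ)‖ * c₀), fun t ht => ?_⟩
    have h1 : U t k ∈ boundedBy μ c₀ := by
      refine hball k hkB t ?_ ht
      rwa [hkf, norm_smul, Complex.norm_real, Real.norm_of_nonneg hl0.le]
    have h2 : U t f₀ ∈ boundedBy μ c₀ := hball f₀ hf₀ t (by rwa [sub_self, norm_zero]) ht
    have h3 : U t g = ((l : ℂ)⁻¹) • (U t k - ((1 - l : ℝ) : ℂ) • U t f₀) := by
      rw [hk, map_add, map_smul, map_smul, add_sub_cancel_left, smul_smul,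
        inv_mul_cancel₀ (by exact_mod_cast hl0.ne'), one_smul]
    rw [h3]
    exact smul_mem_boundedBy (sub_mem_boundedBy h1 (smul_mem_boundedBy h2 _)) _
  -- Times near `t₀` are moved to times near `0` by applying `step` to a rescaling of `U (-t₀) f`.
  -- Dividing by `|d| + 1` avoids a zero or negative bound.
  obtain ⟨d, hd⟩ := mem_Linfty_iff.1 (hU (-t₀) f hf)
  have hd' : U (-t₀) f ∈ boundedBy μ (|d| + 1) :=
    boundedBy_mono (by linarith [le_abs_self d]) hd
  have hpos : 0 < |d| + 1 := by positivity
  have hsc : (((|d| + 1)⁻¹ : ℝ) : ℂ) • U (-t₀) f ∈ boundedBy μ 1 := by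
    have := smul_mem_boundedBy hd' (((|d| + 1)⁻¹ : ℝ) : ℂ)
    rwa [Complex.norm_real, Real.norm_of_nonneg (by positivity), inv_mul_cancel₀ hpos.ne'] at this
  obtain ⟨c, hc⟩ := step _ hsc
  refine ⟨‖((|d| + 1 : ℝ) : ℂ)‖ * c, ?_⟩
  filter_upwards [Metric.ball_mem_nhds (0 : ℝ) hr] with t ht
  have h1 := smul_mem_boundedBy (hc (t + t₀) (by simpa using ht)) ((|d| + 1 : ℝ) : ℂ)
  rwa [map_smul, smul_smul, ← Complex.ofReal_mul, mul_inv_cancel₀ hpos.ne', Complex.ofReal_one,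
    one_smul, ← U.map_add', add_neg_cancel_right] at h1

/-- Averages of orbits belong to the domain of the generator. -/
theorem hasGenerator_integral (U : UnitaryC0Group (Lp ℂ 2 μ)) (f : Lp ℂ 2 μ) (a : ℝ) :
    HasGenerator U (∫ s in (0 : ℝ)..a, U s f) (U a f - f) := by
  rw [hasGenerator_iff_hasDerivAt]
  have hc := U.continuous' f
  have key : ∀ t, U t (∫ s in (0 : ℝ)..a, U s f)
      = (∫ s in (0 : ℝ)..(t + a), U s f) - ∫ s in (0 : ℝ)..t, U s f := by
    intro t
    have h1 := ((U t).toContinuousLinearEquiv.toContinuousLinearMap).intervalIntegral_comp_comm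
      (hc.intervalIntegrable (μ := volume) 0 a)
    have h2 : U t (∫ s in (0 : ℝ)..a, U s f) = ∫ s in (0 : ℝ)..a, U (t + s) f := by
      simp only [U.map_add']
      exact h1.symm
    rw [h2, intervalIntegral.integral_comp_add_left (fun s => U s f), add_zero,
      intervalIntegral.integral_interval_sub_left (hc.intervalIntegrable _ _)
        (hc.intervalIntegrable _ _)]
  simp only [key]
  have d1 := ((hc.integral_hasStrictDerivAt 0 (0 + a)).hasDerivAt).comp_add_const 0 a
  have d2 := (hc.integral_hasStrictDerivAt 0 0).hasDerivAt
  have d3 := d1.sub d2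
  rwa [zero_add, U.map_zero'] at d3

/-- The averages of `U s f` over `[0, a]` lie in the domain and tend to `f`. For small `a` the orbit
stays in the closed convex set `boundedBy μ c`, hence so do its averages. -/
theorem mem_closure_domain_inf_Linfty (hU : ∀ t : ℝ, ∀ f ∈ Linfty μ, U t f ∈ Linfty μ)
    {f : Lp ℂ 2 μ} (hf : f ∈ Linfty μ) :
    f ∈ closure (((generator U).domain ⊓ Linfty μ : Submodule ℂ (Lp ℂ 2 μ)) :
      Set (Lp ℂ 2 μ)) := by
  have hc := U.continuous' f
  obtain ⟨c, hcb⟩ := eventually_apply_mem_boundedBy hU hf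
  obtain ⟨r, hr, hball⟩ := Metric.eventually_nhds_iff.1 hcb
  have hlim : Tendsto (fun a : ℝ => a⁻¹ • ∫ s in (0 : ℝ)..a, U s f) (𝓝[≠] 0) (𝓝 f) := by
    have := (hc.integral_hasStrictDerivAt 0 0).hasDerivAt
    rw [hasDerivAt_iff_tendsto_slope_zero, U.map_zero'] at this
    simpa using this
  refine mem_closure_of_tendsto (hlim.mono_left (nhdsGT_le_nhdsNE 0)) ?_
  filter_upwards [Ioo_mem_nhdsGT hr] with a ha
  refine Submodule.mem_inf.2 ⟨?_, mem_Linfty_iff.2 ⟨c, ?_⟩⟩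
  · exact Submodule.smul_of_tower_mem _ _ ⟨_, hasGenerator_integral U f a⟩
  · have h1 := interval_average_eq (fun s => U s f) 0 a
    rw [sub_zero] at h1
    rw [← h1]
    refine (convex_boundedBy c).set_average_mem (isClosed_boundedBy c) ?_ ?_ ?_ ?_
    · simp [Set.uIoc_of_le ha.1.le, ha.1]
    · simp [Set.uIoc_of_le ha.1.le]
    · refine (ae_restrict_mem measurableSet_uIoc).mono fun s hs => hball ?_
      rw [Set.uIoc_of_le ha.1.le] at hs
      rw [Real.dist_eq, sub_zero, abs_of_pos hs.1]
      exact hs.2.trans_lt ha.2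
    · exact (intervalIntegrable_iff.1 (hc.intervalIntegrable 0 a))

/-! ### From derivation to multiplicativity -/

/-- If the generator is a derivation on the bounded functions in its domain, then `U` is
multiplicative on these functions. -/
theorem apply_mul_of_mem_domain (hU : ∀ t : ℝ, ∀ f ∈ Linfty μ, U t f ∈ Linfty μ)
    (hA : IsAlgebra ((generator U).domain ⊓ Linfty μ))
    (hD : IsDerivationOn (generator U) ((generator U).domain ⊓ Linfty μ)) (t : ℝ)
    {f g h : Lp ℂ 2 μ} (hf : f ∈ (generator U).domain ⊓ Linfty μ)
    (hg : g ∈ (generator U).domain ⊓ Linfty μ) (hh : h =ᵐ[μ] fun x => f x * g x) :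
    U t h =ᵐ[μ] fun x => U t f x * U t g x := by
  have hinv : ∀ s, ∀ k ∈ (generator U).domain ⊓ Linfty μ,
      U s k ∈ (generator U).domain ⊓ Linfty μ := fun s k hk =>
    Submodule.mem_inf.2 ⟨⟨_, (hasGenerator_generator hk.1).apply s⟩, hU s k hk.2⟩
  -- Here `q s` is the product `U s f * U s g`. Its derivative is given by the product rule and
  -- equals `A (q s)` by the derivation property, so `U (-s) (q s)` keeps its initial value `h`.
  choose q hq hqm using fun s => hA _ (hinv s f hf) _ (hinv s g hg)
  have hderiv : ∀ s, HasDerivAt (fun s => U (-s) (q s)) 0 s := by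
    intro s
    refine hasDerivAt_apply_neg ?_ (hasGenerator_generator (hq s).1)
    obtain ⟨c, hc⟩ := eventually_apply_mem_boundedBy hU (hinv s g hg).2
    refine hasDerivAt_mul (c := c) ((hasGenerator_generator hf.1).hasDerivAt s)
      ((hasGenerator_generator hg.1).hasDerivAt s) (mem_Linfty_iff.1 (hinv s f hf).2) ?_ hqm ?_
    · have : Tendsto (fun t => t - s) (𝓝 s) (𝓝 0) := by
        simpa using (continuous_id.sub continuous_const).tendsto (f := fun t : ℝ => t - s) s
      filter_upwards [this.eventually hc] with t ht
      rwa [← U.map_add', sub_add_cancel] at ht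
    · have := hD.2 ⟨_, (hinv s f hf).1⟩ ⟨_, (hinv s g hg).1⟩ ⟨_, (hq s).1⟩ (hinv s f hf)
        (hinv s g hg) (hq s) (hqm s)
      rwa [(hasGenerator_generator (hinv s f hf).1).unique
          ((hasGenerator_generator hf.1).apply s),
        (hasGenerator_generator (hinv s g hg).1).unique
          ((hasGenerator_generator hg.1).apply s)] at this
  have hconst := is_const_of_deriv_eq_zero (fun s => (hderiv s).differentiableAt)
    (fun s => (hderiv s).deriv) t 0
  have h0 : q 0 = h := by
    refine Lp.ext ?_
    filter_upwards [hqm 0, hh] with x h1 h2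
    rw [h1, h2, U.map_zero', U.map_zero']
  simp only [h0, neg_zero, U.map_zero'] at hconst
  rw [← hconst, ← U.map_add', add_neg_cancel, U.map_zero']
  exact hqm t

/-- Multiplicativity with a fixed bounded factor passes to the closure in the other factor. -/
theorem apply_mul_of_mem_closure {V : Lp ℂ 2 μ ≃ₗᵢ[ℂ] Lp ℂ 2 μ} {D : Set (Lp ℂ 2 μ)}
    {g : Lp ℂ 2 μ} (hg : g ∈ Linfty μ) (hVg : V g ∈ Linfty μ)
    (hD : ∀ f ∈ D, ∀ h : Lp ℂ 2 μ, (h =ᵐ[μ] fun x => f x * g x) →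
      V h =ᵐ[μ] fun x => V f x * V g x) {f h : Lp ℂ 2 μ} (hf : f ∈ closure D)
    (hh : h =ᵐ[μ] fun x => f x * g x) : V h =ᵐ[μ] fun x => V f x * V g x := by
  obtain ⟨c, hc⟩ := mem_Linfty_iff.1 hg
  obtain ⟨d, hd⟩ := mem_Linfty_iff.1 hVg
  obtain ⟨u, huD, hu⟩ := mem_closure_iff_seq_limit.1 hf
  choose w hw using fun n => exists_mul_eq_of_mem_boundedBy (u n) hc
  have t1 : Tendsto w atTop (𝓝 h) :=
    tendsto_mul hu tendsto_const_nhds hc (Eventually.of_forall fun _ => hc) hw hh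
  obtain ⟨k, hk⟩ := exists_mul_eq_of_mem_boundedBy (V f) hd
  have t2 : Tendsto (fun n => V (w n)) atTop (𝓝 k) :=
    tendsto_mul ((V.continuous.tendsto f).comp hu) tendsto_const_nhds hd
      (Eventually.of_forall fun _ => hd) (fun n => hD _ (huD n) _ (hw n)) hk
  rw [tendsto_nhds_unique ((V.continuous.tendsto h).comp t1) t2]
  exact hk

/-- Multiplication is `L_2`-continuous in one factor while the other is a fixed bounded function, so
the two factors are approximated one at a time. -/
theorem apply_mul_of_mem_Linfty (hU : ∀ t : ℝ, ∀ f ∈ Linfty μ, U t f ∈ Linfty μ)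
    (hA : IsAlgebra ((generator U).domain ⊓ Linfty μ))
    (hD : IsDerivationOn (generator U) ((generator U).domain ⊓ Linfty μ)) (t : ℝ)
    {f g h : Lp ℂ 2 μ} (hf : f ∈ Linfty μ) (hg : g ∈ Linfty μ)
    (hh : h =ᵐ[μ] fun x => f x * g x) : U t h =ᵐ[μ] fun x => U t f x * U t g x := by
  refine apply_mul_of_mem_closure hg (hU t g hg) (fun f hf h hh => ?_)
    (mem_closure_domain_inf_Linfty hU hf) hh
  refine ae_eq_mul_comm (apply_mul_of_mem_closure hf.2 (hU t f hf.2) (fun g hg h hh => ?_)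
    (mem_closure_domain_inf_Linfty hU hg) (ae_eq_mul_comm hh))
  exact ae_eq_mul_comm (apply_mul_of_mem_domain hU hA hD t hf hg (ae_eq_mul_comm hh))

end Group

end Koopman

namespace Koopman

/-! ### Indicator functions in `L_2` -/

section PointMap

variable {X : Type*} [MeasurableSpace X] {μ : Measure X} [IsProbabilityMeasure μ]

/-- The class in `L_2` of the indicator function of a measurable set. -/
noncomputable def ind (μ : Measure X) [IsProbabilityMeasure μ] {s : Set X}
    (hs : MeasurableSet s) : Lp ℂ 2 μ := indicatorConstLp 2 hs (measure_ne_top μ s) 1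

theorem coeFn_ind {s : Set X} (hs : MeasurableSet s) :
    ind μ hs =ᵐ[μ] s.indicator fun _ => (1 : ℂ) := indicatorConstLp_coeFn

theorem ind_mem_Linfty {s : Set X} (hs : MeasurableSet s) : ind μ hs ∈ Linfty μ := by
  refine mem_Linfty_iff.2 ⟨1, ?_⟩
  filter_upwards [coeFn_ind (μ := μ) hs] with x hx
  rw [hx]
  by_cases h : x ∈ s <;> simp [h]

theorem ind_eq_ind_iff {s t : Set X} (hs : MeasurableSet s) (ht : MeasurableSet t) :
    ind μ hs = ind μ ht ↔ s =ᵐ[μ] t := by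
  constructor
  · intro h
    filter_upwards [(coeFn_ind hs).symm.trans (h ▸ coeFn_ind ht)] with x hx
    refine propext ?_
    change x ∈ s ↔ x ∈ t
    by_cases a : x ∈ s <;> by_cases b : x ∈ t <;> simp_all
  · intro h
    exact Lp.ext ((coeFn_ind hs).trans
      ((indicator_ae_eq_of_ae_eq_set h).trans (coeFn_ind ht).symm))

theorem ind_inter {s t : Set X} (hs : MeasurableSet s) (ht : MeasurableSet t) :
    ind μ (hs.inter ht) =ᵐ[μ] fun x => ind μ hs x * ind μ ht x := by
  filter_upwards [coeFn_ind (μ := μ) hs, coeFn_ind (μ := μ) ht, coeFn_ind (μ := μ) (hs.inter ht)]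
    with x h1 h2 h3
  rw [h1, h2, h3]
  by_cases a : x ∈ s <;> by_cases b : x ∈ t <;> simp [a, b]

theorem ind_compl {s : Set X} (hs : MeasurableSet s) :
    ind μ hs.compl = ind μ MeasurableSet.univ - ind μ hs := by
  refine Lp.ext ?_
  filter_upwards [coeFn_ind (μ := μ) hs, coeFn_ind (μ := μ) hs.compl,
    coeFn_ind (μ := μ) MeasurableSet.univ, Lp.coeFn_sub (ind μ MeasurableSet.univ) (ind μ hs)]
    with x h1 h2 h3 h4
  rw [h4, Pi.sub_apply, h1, h2, h3]
  by_cases a : x ∈ s <;> simp [a]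

theorem measure_eq_of_norm_ind_eq {s t : Set X} {hs : MeasurableSet s} {ht : MeasurableSet t}
    (h : ‖ind μ hs‖ = ‖ind μ ht‖) : μ s = μ t := by
  rw [ind, ind, norm_indicatorConstLp (by simp) (by simp),
    norm_indicatorConstLp (by simp) (by simp), norm_one, one_mul, one_mul,
    Real.rpow_left_inj measureReal_nonneg measureReal_nonneg (by simp)] at h
  exact (ENNReal.toReal_eq_toReal_iff' (measure_ne_top _ _) (measure_ne_top _ _)).1 h

theorem measurableSet_accumulate {Y : Type*} [MeasurableSpace Y] {s : ℕ → Set Y}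
    (hs : ∀ n, MeasurableSet (s n)) (n : ℕ) : MeasurableSet (Set.accumulate s n) :=
  MeasurableSet.biUnion (Set.to_countable _) fun i _ => hs i

/-- The part of the union not yet covered decreases to the empty set, so its finite measure tends to
`0`. Countable unions thus become `L_2` limits, which a unitary operator respects. -/
theorem tendsto_ind_accumulate {s : ℕ → Set X} (hs : ∀ n, MeasurableSet (s n)) :
    Tendsto (fun n => ind μ (measurableSet_accumulate hs n)) atTop
      (𝓝 (ind μ (MeasurableSet.iUnion hs))) := by
  refine tendsto_indicatorConstLp_set (by simp) ?_
  have h : ∀ n, symmDiff (Set.accumulate s n) (⋃ i, s i) = (⋃ i, s i) \ Set.accumulate s n := by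
    intro n
    rw [Set.symmDiff_def, Set.sdiff_eq_empty.2 (Set.accumulate_subset_iUnion n), Set.empty_union]
  simp only [h]
  have hmeas := fun n => (MeasurableSet.iUnion hs).diff (measurableSet_accumulate hs n)
  have := tendsto_measure_iInter_atTop (μ := μ) (fun n => (hmeas n).nullMeasurableSet)
    (fun m n hmn => Set.sdiff_subset_sdiff_right (Set.monotone_accumulate hmn))
    ⟨0, measure_ne_top _ _⟩
  rwa [← Set.sdiff_iUnion, Set.iUnion_accumulate, Set.sdiff_self, measure_empty] at this

/-! ### Multiplicative unitaries and point maps -/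

variable {V : Lp ℂ 2 μ ≃ₗᵢ[ℂ] Lp ℂ 2 μ}

/-- A unitary operator that is multiplicative on bounded functions. -/
def IsMultiplicative (V : Lp ℂ 2 μ ≃ₗᵢ[ℂ] Lp ℂ 2 μ) : Prop :=
  ∀ f ∈ Linfty μ, ∀ g ∈ Linfty μ, ∀ h : Lp ℂ 2 μ, (h =ᵐ[μ] fun x => f x * g x) →
    V h =ᵐ[μ] fun x => V f x * V g x

/-- An indicator equals its square, hence so does its image, which therefore takes only the values
`0` and `1` a.e. -/
theorem IsMultiplicative.exists_apply_ind (hV : IsMultiplicative V) {s : Set X}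
    (hs : MeasurableSet s) : ∃ (t : Set X) (ht : MeasurableSet t), V (ind μ hs) = ind μ ht := by
  have hm : MeasurableSet {x | V (ind μ hs) x = 1} :=
    (Lp.stronglyMeasurable (V (ind μ hs))).measurable (measurableSet_singleton 1)
  refine ⟨_, hm, Lp.ext ?_⟩
  have h := ind_inter (μ := μ) hs hs
  simp only [Set.inter_self] at h
  filter_upwards [hV _ (ind_mem_Linfty hs) _ (ind_mem_Linfty hs) _ h, coeFn_ind (μ := μ) hm]
    with x h1 h2
  rw [h2]
  by_cases hx : V (ind μ hs) x = 1
  · rw [Set.indicator_of_mem (by exact hx), hx]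
  · rw [Set.indicator_of_notMem (by exact hx)]
    by_contra h0
    exact hx (mul_left_cancel₀ h0 (by rw [mul_one]; exact h1.symm))

/-- The image is the indicator of a set which, by isometry, has full measure. -/
theorem IsMultiplicative.apply_ind_univ (hV : IsMultiplicative V) :
    V (ind μ MeasurableSet.univ) = ind μ MeasurableSet.univ := by
  obtain ⟨t, ht, h⟩ := hV.exists_apply_ind MeasurableSet.univ
  rw [h, ind_eq_ind_iff]
  have h1 : μ Set.univ = μ t := measure_eq_of_norm_ind_eq (hs := MeasurableSet.univ) (ht := ht)
    (by rw [← h, LinearIsometryEquiv.norm_map])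
  rw [ae_eq_univ, prob_compl_eq_zero_iff ht, ← h1, measure_univ]

/-- The sets with this property form a σ-algebra: complements use that `V` fixes the constant `1`,
intersections use multiplicativity, and countable unions are `L_2` limits of finite ones. -/
theorem IsMultiplicative.apply_ind_preimage (hV : IsMultiplicative V) {Y : Type*}
    {C : Set (Set Y)} {φ G : X → Y}
    (hφ : Measurable[_, MeasurableSpace.generateFrom C] φ)
    (hG : Measurable[_, MeasurableSpace.generateFrom C] G)
    (hC : ∀ s (hs : s ∈ C), V (ind μ (hφ (MeasurableSpace.measurableSet_generateFrom hs)))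
      = ind μ (hG (MeasurableSpace.measurableSet_generateFrom hs)))
    (s : Set Y) (hs : MeasurableSet[MeasurableSpace.generateFrom C] s) :
    V (ind μ (hφ hs)) = ind μ (hG hs) := by
  let _ : MeasurableSpace Y := MeasurableSpace.generateFrom C
  have hcompl : ∀ t (ht : MeasurableSet t), V (ind μ (hφ ht)) = ind μ (hG ht) →
      V (ind μ (hφ ht.compl)) = ind μ (hG ht.compl) := fun t ht h => by
    have h1 := ind_compl (μ := μ) (hφ ht)
    have h2 := ind_compl (μ := μ) (hG ht)
    exact (congrArg V h1).trans (by rw [map_sub, hV.apply_ind_univ, h]; exact h2.symm)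
  have hinter : ∀ t (ht : MeasurableSet t) t' (ht' : MeasurableSet t'),
      V (ind μ (hφ ht)) = ind μ (hG ht) → V (ind μ (hφ ht')) = ind μ (hG ht') →
      V (ind μ (hφ (ht.inter ht'))) = ind μ (hG (ht.inter ht')) := fun t ht t' ht' h h' => by
    refine Lp.ext ((hV _ (ind_mem_Linfty (hφ ht)) _ (ind_mem_Linfty (hφ ht')) _
      (ind_inter (hφ ht) (hφ ht'))).trans ?_)
    rw [h, h']
    exact (ind_inter (hG ht) (hG ht')).symm
  have hunion : ∀ t (ht : MeasurableSet t) t' (ht' : MeasurableSet t'),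
      V (ind μ (hφ ht)) = ind μ (hG ht) → V (ind μ (hφ ht')) = ind μ (hG ht') →
      V (ind μ (hφ (ht.union ht'))) = ind μ (hG (ht.union ht')) := fun t ht t' ht' h h' => by
    have := hcompl _ (ht.compl.inter ht'.compl)
      (hinter _ ht.compl _ ht'.compl (hcompl _ ht h) (hcompl _ ht' h'))
    simpa only [← Set.compl_union, compl_compl] using this
  refine MeasurableSpace.generateFrom_induction C
    (fun s hs => V (ind μ (hφ hs)) = ind μ (hG hs)) (fun t ht _ => hC t ht) ?_
    (fun t ht h => hcompl t ht h) (fun t ht h => ?_) s hs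
  · have := hcompl _ MeasurableSet.univ hV.apply_ind_univ
    simpa only [Set.compl_univ] using this
  · have hacc : ∀ n, V (ind μ (hφ (measurableSet_accumulate ht n)))
        = ind μ (hG (measurableSet_accumulate ht n)) := by
      intro n
      induction n with
      | zero => simpa only [Set.accumulate_zero_nat] using h 0
      | succ n ih =>
        simpa only [Set.accumulate_succ] using hunion _ (measurableSet_accumulate ht n) _ (ht (n + 1)) ih (h (n + 1))
    have pre : ∀ (ψ : X → Y) n, ψ ⁻¹' Set.accumulate t n
        = Set.accumulate (fun i => ψ ⁻¹' t i) n := fun ψ n => by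
      simp only [Set.accumulate_def, Set.preimage_iUnion]
    have t1 := tendsto_ind_accumulate (μ := μ) fun n => hφ (ht n)
    have t2 := tendsto_ind_accumulate (μ := μ) fun n => hG (ht n)
    have t3 := (V.continuous.tendsto _).comp t1
    have hacc' : ∀ n, V (ind μ (measurableSet_accumulate (fun n => hφ (ht n)) n))
        = ind μ (measurableSet_accumulate (fun n => hG (ht n)) n) := by
      intro n
      have := hacc n
      simpa only [pre] using this
    have := tendsto_nhds_unique (t3.congr fun n => hacc' n) t2
    simpa only [Set.preimage_iUnion] using this

theorem pi_bool_eq_generateFrom : (MeasurableSpace.pi : MeasurableSpace (ℕ → Bool)) =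
    MeasurableSpace.generateFrom (Set.range fun n : ℕ => {z : ℕ → Bool | z n = true}) := by
  refine le_antisymm (iSup_le fun n => ?_) (MeasurableSpace.generateFrom_le ?_)
  · rw [← measurable_iff_comap_le]
    exact measurable_to_bool (MeasurableSpace.measurableSet_generateFrom ⟨n, rfl⟩)
  · rintro _ ⟨n, rfl⟩
    exact (measurable_pi_apply (X := fun _ => Bool) n) (measurableSet_singleton true)

/-- A unitary operator that is multiplicative on bounded functions is the composition operator of
a point map. -/
theorem IsMultiplicative.exists_measurePreserving [StandardBorelSpace X]
    (hV : IsMultiplicative V) :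
    ∃ T : X → X, MeasurePreserving T μ μ ∧ ∀ f : Lp ℂ 2 μ, V f =ᵐ[μ] fun x => f (T x) := by
  have hne : Nonempty X := μ.nonempty_of_neZero
  -- The sets `B n` separate points, so `φ` embeds `X` into `ℕ → Bool`. The desired `T` must pull `B
  -- n` back to `C n` up to null sets, that is, `φ ∘ T = G` a.e.
  set B := MeasurableSpace.natGeneratingSequence X
  have hB : ∀ n, MeasurableSet (B n) := MeasurableSpace.measurableSet_natGeneratingSequence
  choose C hC hBC using fun n => hV.exists_apply_ind (hB n)
  set φ := MeasurableSpace.mapNatBool X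
  have hφ : Measurable φ := MeasurableSpace.measurable_mapNatBool X
  have hemb : MeasurableEmbedding φ :=
    hφ.measurableEmbedding (MeasurableSpace.injective_mapNatBool X)
  classical
  let G : X → ℕ → Bool := fun x n => decide (x ∈ C n)
  have hGpre : ∀ n, G ⁻¹' {z : ℕ → Bool | z n = true} = C n := fun n => by
    ext x; simp [G]
  have hφpre : ∀ n, φ ⁻¹' {z : ℕ → Bool | z n = true} = B n := fun n => by
    ext x; simp [φ, MeasurableSpace.mapNatBool, B]
  have hG : Measurable G := measurable_pi_lambda _ fun n => measurable_to_bool <| by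
    have : (fun x => G x n) ⁻¹' {true} = C n := hGpre n
    rw [this]; exact hC n
  have hpre : ∀ s (hs : MeasurableSet s), V (ind μ (hφ hs)) = ind μ (hG hs) := by
    have hφ' := hφ
    have hG' := hG
    rw [pi_bool_eq_generateFrom] at hφ' hG'
    intro s hs
    rw [pi_bool_eq_generateFrom] at hs
    refine hV.apply_ind_preimage hφ' hG' ?_ s hs
    rintro _ ⟨n, rfl⟩
    simpa only [hφpre, hGpre] using hBC n
  -- The range of `φ` pulls back to all of `X` under `φ`, and `V` fixes the constant `1`, so its
  -- preimage under `G` is conull. Off it, the default value of `invFun` is harmless.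
  have hrange : ∀ᵐ x ∂μ, G x ∈ Set.range φ := by
    have h1 := hpre _ hemb.measurableSet_range
    have h2 : V (ind μ (hφ hemb.measurableSet_range)) = ind μ MeasurableSet.univ := by
      simpa only [Set.preimage_range] using hV.apply_ind_univ
    rw [h2, ind_eq_ind_iff] at h1
    filter_upwards [h1.mem_iff] with x hx
    exact hx.1 (Set.mem_univ x)
  let T : X → X := fun x => hemb.invFun (G x)
  have hT : Measurable T := hemb.measurable_invFun.comp hG
  have hind : ∀ s (hs : MeasurableSet s), V (ind μ hs) = ind μ (hT hs) := by
    intro s hs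
    have h1 := hpre _ (hemb.measurableSet_image' hs)
    have h2 : V (ind μ (hφ (hemb.measurableSet_image' hs))) = V (ind μ hs) := by
      refine congrArg V ?_
      rw [ind_eq_ind_iff, Set.preimage_image_eq _ hemb.injective]
      exact EventuallyEq.rfl
    rw [← h2, h1, ind_eq_ind_iff]
    filter_upwards [hrange] with x ⟨y, hy⟩
    refine propext ?_
    change G x ∈ φ '' s ↔ hemb.invFun (G x) ∈ s
    rw [← hy, hemb.leftInverse_invFun y, hemb.injective.mem_set_image]
  have hTm : MeasurePreserving T μ μ := by
    refine ⟨hT, Measure.ext fun s hs => ?_⟩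
    rw [Measure.map_apply hT hs]
    refine (measure_eq_of_norm_ind_eq (hs := hs) (ht := hT hs) ?_).symm
    rw [← hind, LinearIsometryEquiv.norm_map]
  refine ⟨T, hTm, fun f => ?_⟩
  suffices h : V f = Lp.compMeasurePreserving T hTm f by
    rw [h]; exact Lp.coeFn_compMeasurePreserving f hTm
  have hcont : Continuous fun f : Lp ℂ 2 μ => Lp.compMeasurePreserving T hTm f :=
    (Lp.isometry_compMeasurePreserving hTm).continuous
  refine Lp.induction (by simp) (fun f => V f = Lp.compMeasurePreserving T hTm f) ?_ ?_
    (isClosed_eq V.continuous hcont) f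
  · intro c s hs hμs
    have h1 : (Lp.simpleFunc.indicatorConst 2 hs hμs.ne c : Lp ℂ 2 μ) = c • ind μ hs := by
      rw [Lp.simpleFunc.coe_indicatorConst]
      refine Lp.ext ?_
      filter_upwards [Lp.coeFn_smul c (ind μ hs), coeFn_ind (μ := μ) hs,
        indicatorConstLp_coeFn (p := 2) (hs := hs) (hμs := hμs.ne) (c := c)] with x h1 h2 h3
      rw [h1, h3, Pi.smul_apply, h2]
      by_cases a : x ∈ s <;> simp [a]
    rw [h1, map_smul, hind]
    refine Lp.ext ?_
    filter_upwards [Lp.coeFn_smul c (ind μ (hT hs)), coeFn_ind (μ := μ) (hT hs),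
      Lp.coeFn_compMeasurePreserving (c • ind μ hs) hTm,
      hTm.quasiMeasurePreserving.ae (Lp.coeFn_smul c (ind μ hs)),
      hTm.quasiMeasurePreserving.ae (coeFn_ind (μ := μ) hs)] with x h1 h2 h3 h4 h5
    rw [h1, h3, Function.comp_apply, h4, Pi.smul_apply, Pi.smul_apply, h2, h5]
    rfl
  · intro f g hf hg _ h1 h2
    rw [map_add, map_add, h1, h2]

/-- By `hST`, composition with `S` and then with `T` fixes the indicators of the generating
sequence. These are countably many sets separating points, so one null set suffices. -/
theorem ae_comp_eq_self [StandardBorelSpace X] {S T : X → X} (hT : MeasurePreserving T μ μ)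
    (hST : ∀ f g : Lp ℂ 2 μ, (g =ᵐ[μ] fun x => f (S x)) → f =ᵐ[μ] fun x => g (T x))
    (hS : MeasurePreserving S μ μ) : ∀ᵐ x ∂μ, S (T x) = x := by
  have hB := MeasurableSpace.measurableSet_natGeneratingSequence (α := X)
  have h : ∀ n, ∀ᵐ x ∂μ, S (T x) ∈ MeasurableSpace.natGeneratingSequence X n ↔
      x ∈ MeasurableSpace.natGeneratingSequence X n := by
    intro n
    have h1 := Lp.coeFn_compMeasurePreserving (ind μ (hB n)) hS
    filter_upwards [hST _ _ h1, hT.quasiMeasurePreserving.ae h1, coeFn_ind (μ := μ) (hB n),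
      (hS.comp hT).quasiMeasurePreserving.ae (coeFn_ind (μ := μ) (hB n))] with x a1 a2 a3 a4
    rw [Function.comp_apply] at a2 a4
    rw [a1, a2, a4] at a3
    by_cases p : S (T x) ∈ MeasurableSpace.natGeneratingSequence X n <;>
      by_cases q : x ∈ MeasurableSpace.natGeneratingSequence X n <;> simp_all
  filter_upwards [ae_all_iff.2 h] with x hx
  refine MeasurableSpace.injective_mapNatBool X (funext fun n => ?_)
  exact decide_eq_decide.2 (hx n)

end PointMap

end Koopman

/-! ### The equivalence -/

open Koopman in
theorem theorem1p1 {X : Type*} [MeasurableSpace X] [StandardBorelSpace X]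
    (μ : Measure X) [IsProbabilityMeasure μ]
    (U : Koopman.UnitaryC0Group (Lp ℂ 2 μ)) :
    (∀ t : ℝ, ∃ T : X → X, MeasurePreserving T μ μ ∧ Koopman.IsAEInvertible μ T ∧
        ∀ f : Lp ℂ 2 μ, U t f =ᵐ[μ] fun x => f (T x)) ↔
      ((∀ t : ℝ, ∀ f ∈ Koopman.Linfty μ, U t f ∈ Koopman.Linfty μ) ∧
        Koopman.IsAlgebra ((Koopman.generator U).domain ⊓ Koopman.Linfty μ) ∧
        Koopman.IsDerivationOn (Koopman.generator U)
          ((Koopman.generator U).domain ⊓ Koopman.Linfty μ)) := by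
  constructor
  · intro hT
    choose T hTm _ hT using hT
    have hB : ∀ t c f, f ∈ boundedBy μ c → U t f ∈ boundedBy μ c := fun t c f hf => by
      filter_upwards [hT t f, (hTm t).quasiMeasurePreserving.ae hf] with x h1 h2
      rwa [h1]
    have hM : ∀ t, ∀ f g h : Lp ℂ 2 μ, (h =ᵐ[μ] fun x => f x * g x) →
        U t h =ᵐ[μ] fun x => U t f x * U t g x := fun t f g h hh => by
      filter_upwards [hT t f, hT t g, hT t h, (hTm t).quasiMeasurePreserving.ae hh]
        with x h1 h2 h3 h4
      rw [h1, h2, h3, h4]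
    refine ⟨fun t f hf => ?_, fun f hf g hg => ?_, inf_le_left, fun f g h hf hg _ hh => ?_⟩
    · obtain ⟨c, hc⟩ := mem_Linfty_iff.1 hf
      exact mem_Linfty_iff.2 ⟨c, hB t c f hc⟩
    · obtain ⟨c, hc⟩ := mem_Linfty_iff.1 hf.2
      obtain ⟨d, hd⟩ := mem_Linfty_iff.1 hg.2
      obtain ⟨h, hh⟩ := exists_mul_eq_of_mem_boundedBy f hd
      obtain ⟨h', hh', -⟩ := exists_hasGenerator_mul hB hM hf.2 hg.2 hh
        (hasGenerator_generator hf.1) (hasGenerator_generator hg.1)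
      exact ⟨h, ⟨⟨h', hh'⟩, mem_Linfty_iff.2 ⟨_, mul_mem_boundedBy hc hd hh⟩⟩, hh⟩
    · obtain ⟨h', hh', he⟩ := exists_hasGenerator_mul hB hM hf.2 hg.2 hh
        (hasGenerator_generator f.2) (hasGenerator_generator g.2)
      rw [(hasGenerator_generator h.2).unique hh']
      exact he
  · rintro ⟨hU, hA, hD⟩
    have hV : ∀ t, IsMultiplicative (U t) := fun t f hf g hg h hh =>
      apply_mul_of_mem_Linfty hU hA hD t hf hg hh
    choose T hTm hT using fun t => (hV t).exists_measurePreserving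
    -- With `g = U (-t) f`, which is `f ∘ T (-t)` a.e., the group law gives `f = U t g = g ∘ T t`
    -- a.e. The other one-sided inverse is the same statement at `-t`.
    have hinv : ∀ t, ∀ᵐ x ∂μ, T (-t) (T t x) = x := fun t => by
      refine ae_comp_eq_self (hTm t) (fun f g hg => ?_) (hTm (-t))
      have h1 : g = U (-t) f := Lp.ext (hg.trans (hT (-t) f).symm)
      have h2 := hT t g
      rwa [h1, ← U.map_add', add_neg_cancel, U.map_zero', ← h1] at h2
    refine fun t => ⟨T t, hTm t, ⟨T (-t), (hTm (-t)).measurable, hinv t, ?_⟩, hT t⟩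
    simpa only [neg_neg] using hinv (-t)
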